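/- For each $n \ge 1$, let $\theta_1^{(n)},\ldots,\theta_n^{(n)}$ be random variables with values in $[0,2\pi)$, defined on a common probability space (which may depend on $n$), with no assumption on their joint distribution. Set $$p_n(z) := \prod_{j=1}^n \bigl(z - e^{i\theta_j^{(n)}}\bigr).$$ Assume: (i) $$\lim_{\delta \searrow 0}\ \limsup_{n\to\infty}\ \mathbb{P}\Bigl(\Bigl|\sum_{j=1}^n e^{-i\theta_j^{(n)}}\Bigr| \le \delta\Bigr) = 0;$$ (ii) for Lebesgue-almost every $z \in \mathbb{D} := \{w \in \mathbb{C} : |w|<1\}$, $$\frac1n \log\Bigl|\sum_{j=1}^n \frac{1}{z - e^{i\theta_j^{(n)}}}\Bigr| \longrightarrow 0 \quad\text{in probability as } n\to\infty,$$ where $\log 0 := -\infty$; (iii) for every integer $m \ge 1$, $$\frac1n \sum_{j=1}^n e^{i m\theta_j^{(n)}} \longrightarrow 0 \quad\text{in probability as } n \to \infty.$$ For $n \ge 2$, let $\mu_{p_n}'$ be the empirical measure of the critical points of $p_n$, that is, $\mu_{p_n}' := \frac{1}{n-1}\sum_{z : p_n'(z)=0} \mathcal{N}(z)\,\delta_z$,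 where $\mathcal{N}(z)$ is the multiplicity of $z$ as a zero of $p_n'$. Then $\mu_{p_n}'$ converges weakly in probability, as $n\to\infty$, to the uniform probability distribution $\mu$ on the unit circle $\{|z|=1\}$: for every bounded continuous $f:\mathbb{C}\to\mathbb{R}$ and every $\varepsilon>0$, $$\lim_{n\to\infty} \mathbb{P}\Bigl(\Bigl|\int f\,d\mu_{p_n}' - \int f\,d\mu\Bigr| > \varepsilon\Bigr) = 0.$$ -/

import Mathlib

open MeasureTheory Filter Topology Polynomial
open scoped ENNReal BoundedContinuousFunction

/-- The empirical measure of the roots of a complex polynomial `f` of degree `n`: the sum of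
`(N_f(z) / n) δ_z` over the distinct roots `z` of `f`, where `N_f(z)` is the multiplicity of `z`.
(It is a probability measure as soon as `f` has degree at least `1`.) -/
noncomputable def rootMeasure (f : ℂ[X]) : Measure ℂ :=
  (f.natDegree : ℝ≥0∞)⁻¹ • ∑ z ∈ f.roots.toFinset, (f.rootMultiplicity z : ℝ≥0∞) • Measure.dirac z

/-- The monic polynomial `∏ j, (z - e^{i t_j})`. -/
noncomputable def polyOfAngles {n : ℕ} (t : Fin n → ℝ) : ℂ[X] :=
  ∏ j, (X - C (Complex.exp (Complex.I * (t j : ℂ))))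

/-- The uniform probability distribution on the unit circle of `ℂ`: the law of `e^{i t}` for `t`
uniformly distributed on `[0, 2π)`. -/
noncomputable def uniformUnitCircle : Measure ℂ :=
  ((ENNReal.ofReal (2 * Real.pi))⁻¹ • (volume : Measure ℝ).restrict (Set.Ico 0 (2 * Real.pi))).map
    (fun t : ℝ => Complex.exp (Complex.I * (t : ℂ)))

/-- Convergence in probability of `X n` to the constant `c`. The `n`-th random element may live on
its own probability space `(Ω n, P n)`; a common space is the case of constant families. -/
def TendstoInProb {Ω : ℕ → Type*} [∀ n, MeasurableSpace (Ω n)] (P : ∀ n, Measure (Ω n))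
    {E : Type*} [PseudoMetricSpace E] (X : ∀ n, Ω n → E) (c : E) : Prop :=
  ∀ ε : ℝ, 0 < ε → Tendsto (fun n => P n {ω | ε < dist (X n ω) c}) atTop (𝓝 0)

/-- Convergence in probability to `0` of random variables with values in `[-∞, ∞]`
(here `EReal.abs` takes the value `∞` at `-∞` and at `∞`). -/
def ERealTendstoZeroInProb {Ω : ℕ → Type*} [∀ n, MeasurableSpace (Ω n)] (P : ∀ n, Measure (Ω n))
    (X : ∀ n, Ω n → EReal) : Prop :=
  ∀ ε : ℝ, 0 < ε → Tendsto (fun n => P n {ω | ENNReal.ofReal ε < (X n ω).abs}) atTop (𝓝 0)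

/-- The random measures `μ n` converge weakly to the measure `ν` in probability: for every bounded
continuous `f`, the integrals `∫ f d(μ n)` converge to `∫ f dν` in probability. -/
def TendstoWeaklyInProb {Ω : ℕ → Type*} [∀ n, MeasurableSpace (Ω n)] (P : ∀ n, Measure (Ω n))
    {T : Type*} [TopologicalSpace T] [MeasurableSpace T]
    (μ : ∀ n, Ω n → Measure T) (ν : Measure T) : Prop :=
  ∀ f : T →ᵇ ℝ, TendstoInProb P (fun n ω => ∫ x, f x ∂(μ n ω)) (∫ x, f x ∂ν)

/-! All critical points lie in the closed disk by Gauss–Lucas, and two facts determine their limit.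
First, evaluating `p'` at `0` gives `n ∏ |w_i| = |∑ z_j⁻¹|`. Anti-concentration keeps this sum away
from `0`, so `∑ (1 - |w_i|) ≤ -∑ log |w_i|` is `O(log n)` with high probability: the critical points
approach the circle on average (`sum_one_sub_norm_le`). Second, the `m`-th power sums of the roots
and of the critical points differ by at most a constant depending only on `m`
(`norm_powerSum_sub_le`), so the normalized power sums of the critical points also tend to `0`.

A test function is approximated uniformly on the circle by a trigonometric polynomial, which extends
to the plane through `z ^ m` and its conjugate. The second fact handles the extension. The
approximation error inside the disk is at most a small constant plus a multiple of `1 - |z|`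
(`exists_le_add_mul_one_sub_norm`), which the first fact handles. -/

/-! ### Power sums of roots and of critical points -/

section PowerSums

/-- The reversed polynomial `∏ j, (1 - z j X)` of `∏ j, (X - z j)`. -/
noncomputable def reversedProd {n : ℕ} (z : Fin n → ℂ) : ℂ[X] :=
  ∏ j, (1 - C (z j) * X)

/-- The sum over `j` of the products `∏ i ≠ j, (1 - z i X)`. -/
noncomputable def reversedDeriv {n : ℕ} (z : Fin n → ℂ) : ℂ[X] :=
  ∑ j, ∏ i ∈ Finset.univ.erase j, (1 - C (z i) * X)

/-- The generating series of the power sums of `z`. -/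
noncomputable def powerSumSeries {n : ℕ} (z : Fin n → ℂ) : PowerSeries ℂ :=
  PowerSeries.mk fun m => ∑ j, z j ^ m

lemma X_mul_derivative_reversedProd {n : ℕ} (z : Fin n → ℂ) :
    X * derivative (reversedProd z) = (n : ℂ[X]) * reversedProd z - reversedDeriv z := by
  have h : (n : ℂ[X]) * reversedProd z = ∑ j : Fin n, reversedProd z := by simp
  rw [h, reversedDeriv, ← Finset.sum_sub_distrib, reversedProd, derivative_prod_finset, Finset.mul_sum]
  refine Finset.sum_congr rfl fun j _ => ?_
  rw [← Finset.mul_prod_erase _ _ (Finset.mem_univ j)]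
  simp
  ring

lemma one_sub_mul_mk_pow (a : ℂ) :
    ((1 - C a * X : ℂ[X]) : PowerSeries ℂ) * PowerSeries.mk (fun m => a ^ m) = 1 := by
  ext m
  rcases m with _ | m
  · simp [sub_mul]
  · simp [sub_mul, mul_assoc, PowerSeries.coeff_succ_X_mul, PowerSeries.coeff_one, pow_succ']

lemma reversedProd_mul_powerSumSeries {n : ℕ} (z : Fin n → ℂ) :
    (reversedProd z : PowerSeries ℂ) * powerSumSeries z = (reversedDeriv z : PowerSeries ℂ) := by
  have h : powerSumSeries z = ∑ j, PowerSeries.mk (fun m => z j ^ m) := by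
    ext m; simp [powerSumSeries]
  have hs : (reversedDeriv z : PowerSeries ℂ)
      = ∑ j, ((∏ i ∈ Finset.univ.erase j, (1 - C (z i) * X) : ℂ[X]) : PowerSeries ℂ) :=
    map_sum (Polynomial.coeToPowerSeries.ringHom (R := ℂ))
      (fun j => ∏ i ∈ Finset.univ.erase j, (1 - C (z i) * X)) Finset.univ
  rw [h, hs, Finset.mul_sum]
  refine Finset.sum_congr rfl fun j _ => ?_
  rw [reversedProd, ← Finset.mul_prod_erase _ _ (Finset.mem_univ j), Polynomial.coe_mul,
    mul_right_comm, one_sub_mul_mk_pow, one_mul]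

/-- Both sides are reversals `x ^ k * p'(x⁻¹)` of the two forms of `p'`; agreement at all `x ≠ 0`
suffices. -/
lemma reversedDeriv_eq {k : ℕ} (z : Fin (k + 1) → ℂ) (w : Fin k → ℂ)
    (h : derivative (∏ j, (X - C (z j))) = C ((k : ℂ) + 1) * ∏ i, (X - C (w i))) :
    reversedDeriv z = C ((k : ℂ) + 1) * reversedProd w := by
  refine Polynomial.eq_of_infinite_eval_eq _ _ ?_
  refine Set.Infinite.mono (s := {0}ᶜ) ?_ (Set.finite_singleton (0 : ℂ)).infinite_compl
  intro x hx
  have hx : x ≠ 0 := hx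
  have aux : ∀ (ι : Type) (s : Finset ι) (v : ι → ℂ),
      ∏ i ∈ s, (1 - v i * x) = x ^ s.card * ∏ i ∈ s, (x⁻¹ - v i) := by
    intro ι s v
    rw [← Finset.prod_const, ← Finset.prod_mul_distrib]
    refine Finset.prod_congr rfl fun i _ => ?_
    field_simp
  have h' := congrArg (eval x⁻¹) h
  simp only [derivative_prod_finset, eval_finsetSum, eval_mul, eval_prod, eval_sub, eval_X, eval_C,
    derivative_sub, derivative_X, derivative_C, sub_zero, mul_one] at h'
  simp only [Set.mem_ofPred_eq, reversedDeriv, reversedProd, eval_finsetSum, eval_mul, eval_prod,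
    eval_sub, eval_X, eval_C,
    eval_one, aux]
  simp only [Finset.card_erase_of_mem (Finset.mem_univ _), Finset.card_univ, Fintype.card_fin,
    Nat.add_sub_cancel, ← Finset.mul_sum, h']
  ring

/-- With `R` the reversed product and `G` the power sum series, `X R'/R` is the number of points
minus `G`. Logarithmic differentiation of `R_z G_z = (k + 1) R_w` gives `(k + 1 - G_z) + X G_z'/G_z
= k - G_w`. The proof is this computation with denominators cleared. -/
lemma powerSumSeries_mul {k : ℕ} (z : Fin (k + 1) → ℂ) (w : Fin k → ℂ)
    (h : derivative (∏ j, (X - C (z j))) = C ((k : ℂ) + 1) * ∏ i, (X - C (w i))) :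
    powerSumSeries z * powerSumSeries w = powerSumSeries z * powerSumSeries z
      - powerSumSeries z - PowerSeries.X * PowerSeries.derivative ℂ (powerSumSeries z) := by
  have h1 := reversedProd_mul_powerSumSeries z
  have h2 := reversedProd_mul_powerSumSeries w
  let φ := Polynomial.coeToPowerSeries.ringHom (R := ℂ)
  have hcast : (((k : ℂ[X]) : ℂ[X]) : PowerSeries ℂ) = k := map_natCast φ k
  have h3 : (PowerSeries.X : PowerSeries ℂ) * (derivative (reversedProd z) : ℂ[X])
      = ((k : PowerSeries ℂ) + 1) * reversedProd z - reversedDeriv z := by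
    simpa [φ, hcast] using congrArg φ (X_mul_derivative_reversedProd z)
  have h4 : (PowerSeries.X : PowerSeries ℂ) * (derivative (reversedProd w) : ℂ[X])
      = (k : PowerSeries ℂ) * reversedProd w - reversedDeriv w := by
    simpa [φ, hcast] using congrArg φ (X_mul_derivative_reversedProd w)
  have h5 : (reversedDeriv z : PowerSeries ℂ) = ((k : PowerSeries ℂ) + 1) * reversedProd w := by
    simpa [φ, hcast] using congrArg φ (reversedDeriv_eq z w h)
  have hz : (reversedProd z : PowerSeries ℂ) ≠ 0 := by
    intro h0
    have := congrArg PowerSeries.constantCoeff h0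
    simp [reversedProd, Polynomial.coeff_zero_prod] at this
  have h6 := congrArg (PowerSeries.derivative ℂ) (h1.trans h5)
  simp only [Derivation.leibniz, smul_eq_mul, map_add, Derivation.map_natCast,
    Derivation.map_one_eq_zero, PowerSeries.derivative_coe, add_zero, mul_zero] at h6
  refine mul_left_cancel₀ hz ?_
  set Gz := powerSumSeries z
  set Gw := powerSumSeries w
  linear_combination (Gw - k - Gz) * h1 + (Gw - k) * h5 + ((k : PowerSeries ℂ) + 1) * h2
    + ((k : PowerSeries ℂ) + 1) * h4 + PowerSeries.X * h6 - Gz * h3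

lemma sum_antidiagonal_powerSums {k : ℕ} (z : Fin (k + 1) → ℂ) (w : Fin k → ℂ)
    (h : derivative (∏ j, (X - C (z j))) = C ((k : ℂ) + 1) * ∏ i, (X - C (w i))) (m : ℕ) :
    ∑ p ∈ Finset.HasAntidiagonal.antidiagonal m, (∑ j, z j ^ p.1) * (∑ i, w i ^ p.2 - ∑ j, z j ^ p.2)
      = -((m : ℂ) + 1) * ∑ j, z j ^ m := by
  have h1 := congrArg (PowerSeries.coeff m) (powerSumSeries_mul z w h)
  have h2 : PowerSeries.coeff m (PowerSeries.X * PowerSeries.derivative ℂ (powerSumSeries z))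
      = m * ∑ j, z j ^ m := by
    rcases m with _ | m
    · simp
    · simp [PowerSeries.coeff_succ_X_mul, PowerSeries.coeff_derivative, powerSumSeries, mul_comm]
  rw [map_sub, map_sub, h2, PowerSeries.coeff_mul, PowerSeries.coeff_mul] at h1
  simp only [powerSumSeries, PowerSeries.coeff_mk] at h1
  simp only [mul_sub, Finset.sum_sub_distrib]
  linear_combination h1

/-- The power sums of the critical points of a polynomial with roots in the closed unit disk differ
from those of its roots by a bounded amount. -/
lemma norm_powerSum_sub_le {k : ℕ} (z : Fin (k + 1) → ℂ) (w : Fin k → ℂ) (hz : ∀ j, ‖z j‖ ≤ 1)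
    (h : derivative (∏ j, (X - C (z j))) = C ((k : ℂ) + 1) * ∏ i, (X - C (w i))) (m : ℕ) :
    ‖∑ i, w i ^ m - ∑ j, z j ^ m‖ ≤ 2 ^ (m + 1) - 1 := by
  have hs : ∀ m, ‖∑ j, z j ^ m‖ ≤ (k : ℝ) + 1 := fun m => by
    refine (norm_sum_le_of_le (n := fun _ => (1 : ℝ)) _ fun j _ => ?_).trans (by simp)
    rw [norm_pow]
    exact pow_le_one₀ (norm_nonneg _) (hz j)
  have hk : (0 : ℝ) < (k : ℝ) + 1 := by positivity
  induction m using Nat.strong_induction_on with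
  | _ m ih =>
  have hrec := sum_antidiagonal_powerSums z w h m
  -- Isolate the term whose root power sum has exponent `0`: that sum is `k + 1`, the coefficient of
  -- the new difference `d m`.
  rw [← Finset.Nat.sum_antidiagonal_swap, Finset.Nat.sum_antidiagonal_eq_sum_range_succ_mk,
    Finset.sum_range_succ] at hrec
  simp only [Prod.swap_prod_mk, Nat.sub_self, pow_zero] at hrec
  set d : ℕ → ℂ := fun m => ∑ i, w i ^ m - ∑ j, z j ^ m with hd
  have hrec' : ((k : ℂ) + 1) * d m = -((m : ℂ) + 1) * ∑ j, z j ^ m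
      - ∑ a ∈ Finset.range m, (∑ j, z j ^ (m - a)) * d a := by
    rw [← hrec]
    simp [hd]
  have hb : ‖((k : ℂ) + 1) * d m‖
      ≤ ((m : ℝ) + 1) * (k + 1) + ∑ a ∈ Finset.range m, ((k : ℝ) + 1) * (2 ^ (a + 1) - 1) := by
    rw [hrec']
    refine (norm_sub_le _ _).trans (add_le_add ?_ (norm_sum_le_of_le _ fun a ha => ?_))
    · rw [norm_mul, norm_neg]
      refine mul_le_mul (le_of_eq ?_) (hs m) (norm_nonneg _) (by positivity)
      exact_mod_cast Complex.norm_natCast (m + 1)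
    · rw [norm_mul]
      exact mul_le_mul (hs _) (ih a (Finset.mem_range.1 ha)) (norm_nonneg _) hk.le
  -- The bound `b m = 2 ^ (m + 1) - 1` solves `b m = (m + 1) + ∑ a < m, b a`.
  have hgeom : ∀ m : ℕ, ∑ a ∈ Finset.range m, ((2 : ℝ) ^ (a + 1) - 1) = 2 ^ (m + 1) - 2 - m := by
    intro m
    induction m with
    | zero => simp
    | succ m ihm => rw [Finset.sum_range_succ, ihm]; push_cast; ring
  have hn : ‖((k : ℂ) + 1)‖ = (k : ℝ) + 1 := by exact_mod_cast Complex.norm_natCast (k + 1)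
  rw [← Finset.mul_sum, hgeom, norm_mul, hn] at hb
  refine le_of_mul_le_mul_left (hb.trans (le_of_eq ?_)) hk
  ring

end PowerSums

/-! ### Location of the critical points and their empirical measure -/

section CriticalPoints

/-- The critical points of a polynomial of degree `k + 1`, listed with multiplicity. -/
lemma exists_criticalPoints {k : ℕ} (z : Fin (k + 1) → ℂ) :
    ∃ w : Fin k → ℂ,
      derivative (∏ j, (X - C (z j))) = C ((k : ℂ) + 1) * ∏ i, (X - C (w i)) := by
  set p : ℂ[X] := ∏ j, (X - C (z j)) with hp
  have hmonic : p.Monic := monic_prod_of_monic _ _ fun j _ => monic_X_sub_C _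
  have hdeg : p.natDegree = k + 1 := by simp [hp]
  have hsplit := IsAlgClosed.splits (derivative p)
  have hcard : (derivative p).roots.card = k := by
    rw [← hsplit.natDegree_eq_card_roots, natDegree_derivative, hdeg]; rfl
  have hlead : (derivative p).leadingCoeff = (k : ℂ) + 1 := by
    rw [leadingCoeff_derivative, hmonic.leadingCoeff, hdeg]; simp
  have hlen : (derivative p).roots.toList.length = k := by simp [hcard]
  refine ⟨fun i => (derivative p).roots.toList.get (i.cast hlen.symm), ?_⟩
  have hroots : (derivative p).roots
      = Finset.univ.val.map fun i : Fin k => (derivative p).roots.toList.get (i.cast hlen.symm) := by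
    conv_lhs => rw [← Multiset.coe_toList (derivative p).roots,
      ← List.ofFn_get (derivative p).roots.toList]
    rw [Fin.univ_val_map, List.ofFn_congr hlen]
  conv_lhs => rw [hsplit.eq_prod_roots, hlead, hroots, Multiset.map_map]
  rfl

/-- Gauss–Lucas, with the closed disk as a convex set containing the roots. -/
lemma norm_criticalPoints_le {k : ℕ} (z : Fin (k + 1) → ℂ) (w : Fin k → ℂ) (hz : ∀ j, ‖z j‖ ≤ 1)
    (h : derivative (∏ j, (X - C (z j))) = C ((k : ℂ) + 1) * ∏ i, (X - C (w i))) (i : Fin k) :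
    ‖w i‖ ≤ 1 := by
  have hk : (k : ℂ) + 1 ≠ 0 := by exact_mod_cast Nat.succ_ne_zero k
  have hdeg : (∏ j, (X - C (z j))).natDegree = k + 1 := by
    simp
  have hmem : w i ∈ (derivative (∏ j, (X - C (z j)))).rootSet ℂ := by
    rw [h, mem_rootSet]
    refine ⟨mul_ne_zero (C_ne_zero.2 hk) (Finset.prod_ne_zero_iff.2 fun i _ => X_sub_C_ne_zero _),
      ?_⟩
    simp [eval_prod, Finset.prod_eq_zero_iff, sub_eq_zero]
  have hsub := rootSet_derivative_subset_convexHull_rootSet (natDegree_pos_iff_degree_pos.1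
    (by rw [hdeg]; omega)) hmem
  have hball : convexHull ℝ ((∏ j, (X - C (z j))).rootSet ℂ) ⊆ Metric.closedBall 0 1 := by
    refine convexHull_min (fun x hx => ?_) (convex_closedBall _ _)
    rw [mem_rootSet] at hx
    have := hx.2
    simp only [coe_aeval_eq_eval, eval_prod, eval_sub, eval_X, eval_C, Finset.prod_eq_zero_iff,
      sub_eq_zero, Finset.mem_univ, true_and] at this
    obtain ⟨j, rfl⟩ := this
    simpa using hz j
  simpa using hball hsub

/-- For roots on the unit circle, the product of the moduli of the critical points is governed by
the sum of the inverse roots. -/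
lemma prod_norm_criticalPoints {k : ℕ} (z : Fin (k + 1) → ℂ) (w : Fin k → ℂ)
    (hz : ∀ j, ‖z j‖ = 1)
    (h : derivative (∏ j, (X - C (z j))) = C ((k : ℂ) + 1) * ∏ i, (X - C (w i))) :
    ((k : ℝ) + 1) * ∏ i, ‖w i‖ = ‖∑ j, (z j)⁻¹‖ := by
  have hne : ∀ j, z j ≠ 0 := fun j h0 => by simpa [h0] using hz j
  -- Compare the two expressions for `|p'(0)|`; the factor `∏ (-z i)` has modulus `1`.
  have h0 := congrArg (fun p => ‖eval 0 p‖) h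
  have hs : ∑ j, ∏ i ∈ Finset.univ.erase j, (-z i) = (∏ i, (-z i)) * -∑ j, (z j)⁻¹ := by
    rw [← Finset.sum_neg_distrib, Finset.mul_sum]
    refine Finset.sum_congr rfl fun j _ => ?_
    rw [← Finset.mul_prod_erase _ _ (Finset.mem_univ j), mul_right_comm]
    field_simp [hne j]
  have hn : ‖((k : ℂ) + 1)‖ = (k : ℝ) + 1 := by exact_mod_cast Complex.norm_natCast (k + 1)
  simp [derivative_prod_finset, eval_finsetSum, eval_prod, hs, hn, hz] at h0
  exact h0.symm

/-- The inequality `1 - x ≤ -log x` turns the product formula into a bound on the sum; a nonzero sum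
of inverse roots keeps every `w i` off `0`. -/
lemma sum_one_sub_norm_le {k : ℕ} (z : Fin (k + 1) → ℂ) (w : Fin k → ℂ) (hz : ∀ j, ‖z j‖ = 1)
    (h : derivative (∏ j, (X - C (z j))) = C ((k : ℂ) + 1) * ∏ i, (X - C (w i))) {δ : ℝ}
    (hδ : 0 < δ) (hσ : δ < ‖∑ j, (z j)⁻¹‖) :
    ∑ i, (1 - ‖w i‖) ≤ Real.log (((k : ℝ) + 1) / δ) := by
  have hprod := prod_norm_criticalPoints z w hz h
  have hk : (0 : ℝ) < (k : ℝ) + 1 := by positivity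
  have hpos : 0 < ∏ i, ‖w i‖ := pos_of_mul_pos_right (by rw [hprod]; linarith) hk.le
  have hw : ∀ i, 0 < ‖w i‖ := fun i =>
    (norm_nonneg _).lt_of_ne' (Finset.prod_ne_zero_iff.1 hpos.ne' i (Finset.mem_univ i))
  calc ∑ i, (1 - ‖w i‖) ≤ ∑ i, -Real.log ‖w i‖ :=
        Finset.sum_le_sum fun i _ => by linarith [Real.log_le_sub_one_of_pos (hw i)]
    _ = Real.log (∏ i, ‖w i‖)⁻¹ := by
        rw [Finset.sum_neg_distrib, Real.log_inv, Real.log_prod fun i _ => (hw i).ne']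
    _ ≤ Real.log (((k : ℝ) + 1) / δ) := by
        refine Real.log_le_log (by positivity) ?_
        rw [le_div_iff₀ hδ, inv_mul_le_iff₀ hpos]
        nlinarith

/-- Integration against the empirical measure of the critical points is averaging. -/
lemma integral_rootMeasure_derivative {E : Type*} [NormedAddCommGroup E] [NormedSpace ℝ E]
    [CompleteSpace E] {k : ℕ} (z : Fin (k + 1) → ℂ) (w : Fin k → ℂ)
    (h : derivative (∏ j, (X - C (z j))) = C ((k : ℂ) + 1) * ∏ i, (X - C (w i))) (f : ℂ → E) :
    ∫ x, f x ∂(rootMeasure (derivative (∏ j, (X - C (z j))))) = (k : ℝ)⁻¹ • ∑ i, f (w i) := by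
  have hk : (k : ℂ) + 1 ≠ 0 := by exact_mod_cast Nat.succ_ne_zero k
  have hroots : (C ((k : ℂ) + 1) * ∏ i, (X - C (w i))).roots = Finset.univ.val.map w := by
    rw [roots_C_mul _ hk]
    have hr := roots_multiset_prod_X_sub_C (Finset.univ.val.map w)
    rw [Multiset.map_map] at hr
    exact hr
  have hdeg : (C ((k : ℂ) + 1) * ∏ i, (X - C (w i))).natDegree = k := by
    rw [natDegree_C_mul hk]; simp
  rw [h, rootMeasure, hdeg, integral_smul_measure, integral_finsetSum_measure]
  · simp only [integral_smul_measure, integral_dirac, ← count_roots]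
    rw [hroots]
    have hsum := Finset.sum_multiset_map_count (Finset.univ.val.map w) f
    rw [Multiset.map_map] at hsum
    have hsum' : ∑ i, f (w i) = _ := hsum
    rw [hsum']
    simp [ENNReal.toReal_inv, Nat.cast_smul_eq_nsmul]
  · intro x _
    exact (integrable_dirac (by simp)).smul_measure (by simp)

end CriticalPoints

/-! ### Specialization to roots given by angles -/

section Angles

lemma exists_criticalPoints_of_angles {k : ℕ} (t : Fin (k + 1) → ℝ) :
    ∃ w : Fin k → ℂ, (∀ i, ‖w i‖ ≤ 1) ∧
      (∀ f : ℂ → ℂ, ∫ x, f x ∂(rootMeasure (derivative (polyOfAngles t)))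
        = (k : ℝ)⁻¹ • ∑ i, f (w i)) ∧
      (∀ f : ℂ → ℝ, ∫ x, f x ∂(rootMeasure (derivative (polyOfAngles t)))
        = (k : ℝ)⁻¹ • ∑ i, f (w i)) ∧
      (∀ m : ℕ, ‖∑ i, w i ^ m - ∑ j, Complex.exp (Complex.I * (t j : ℂ)) ^ m‖
        ≤ 2 ^ (m + 1) - 1) ∧
      ∀ δ : ℝ, 0 < δ → δ < ‖∑ j, Complex.exp (-(Complex.I * (t j : ℂ)))‖ →
        ∑ i, (1 - ‖w i‖) ≤ Real.log (((k : ℝ) + 1) / δ) := by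
  have hz : ∀ j, ‖Complex.exp (Complex.I * (t j : ℂ))‖ = 1 := fun j => by
    rw [mul_comm]; exact Complex.norm_exp_ofReal_mul_I _
  obtain ⟨w, hw⟩ := exists_criticalPoints fun j => Complex.exp (Complex.I * (t j : ℂ))
  refine ⟨w, norm_criticalPoints_le _ w (fun j => (hz j).le) hw,
    integral_rootMeasure_derivative _ w hw, integral_rootMeasure_derivative _ w hw,
    norm_powerSum_sub_le _ w (fun j => (hz j).le) hw, fun δ hδ hσ => ?_⟩
  simp only [Complex.exp_neg] at hσ
  exact sum_one_sub_norm_le _ w hz hw hδ hσ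

end Angles

/-! ### Calculus of convergence in probability -/

section InProbability

variable {Ω : ℕ → Type*} [∀ n, MeasurableSpace (Ω n)] {P : ∀ n, Measure (Ω n)}

lemma TendstoInProb.of_dist_le {E F : Type*} [PseudoMetricSpace E] [PseudoMetricSpace F]
    {X : ∀ n, Ω n → E} {c : E} {Y : ∀ n, Ω n → F} {d : F} (hY : TendstoInProb P Y d)
    (h : ∀ᶠ n in atTop, ∀ ω, dist (X n ω) c ≤ dist (Y n ω) d) : TendstoInProb P X c := by
  intro ε hε
  refine tendsto_of_tendsto_of_tendsto_of_le_of_le' tendsto_const_nhds (hY ε hε)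
    (Eventually.of_forall fun n => zero_le) ?_
  filter_upwards [h] with n hn
  exact measure_mono fun ω (hω : ε < _) => hω.trans_le (hn ω)

/-- Domination, up to arbitrarily small errors, by random variables tending to `0`. -/
lemma tendstoInProb_of_forall_dist_le {E : Type*} [PseudoMetricSpace E]
    {X : ∀ n, Ω n → E} {c : E}
    (h : ∀ ε : ℝ, 0 < ε → ∃ Y : ∀ n, Ω n → ℝ, TendstoInProb P Y 0 ∧
      ∀ᶠ n in atTop, ∀ ω, dist (X n ω) c ≤ ε + Y n ω) : TendstoInProb P X c := by
  intro ε hε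
  obtain ⟨Y, hY, hXY⟩ := h (ε / 2) (half_pos hε)
  refine tendsto_of_tendsto_of_tendsto_of_le_of_le' tendsto_const_nhds (hY (ε / 2) (half_pos hε))
    (Eventually.of_forall fun n => zero_le) ?_
  filter_upwards [hXY] with n hn
  refine measure_mono fun ω (hω : ε < _) => ?_
  show ε / 2 < dist (Y n ω) 0
  rw [Real.dist_0_eq_abs]
  linarith [hn ω, le_abs_self (Y n ω)]

lemma TendstoInProb.add {E : Type*} [SeminormedAddCommGroup E] {X Y : ∀ n, Ω n → E} {a b : E}
    (hX : TendstoInProb P X a) (hY : TendstoInProb P Y b) :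
    TendstoInProb P (fun n ω => X n ω + Y n ω) (a + b) := by
  intro ε hε
  have hsum := (hX (ε / 2) (half_pos hε)).add (hY (ε / 2) (half_pos hε))
  rw [add_zero] at hsum
  refine tendsto_of_tendsto_of_tendsto_of_le_of_le tendsto_const_nhds hsum
    (fun n => zero_le) fun n => ?_
  refine (measure_mono fun ω (hω : ε < _) => ?_).trans (measure_union_le _ _)
  by_contra hcon
  simp only [Set.mem_union, Set.mem_ofPred_eq, not_or, not_lt] at hcon
  linarith [dist_add_add_le (X n ω) (Y n ω) a b, hcon.1, hcon.2]

lemma TendstoInProb.dist {E : Type*} [PseudoMetricSpace E] {X : ∀ n, Ω n → E} {c : E}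
    (hX : TendstoInProb P X c) : TendstoInProb P (fun n ω => dist (X n ω) c) 0 :=
  hX.of_dist_le (Eventually.of_forall fun n ω => by simp)

lemma TendstoInProb.const_mul {𝕜 : Type*} [NormedField 𝕜] {X : ∀ n, Ω n → 𝕜} {c : 𝕜}
    (hX : TendstoInProb P X c) (a : 𝕜) : TendstoInProb P (fun n ω => a * X n ω) (a * c) := by
  intro ε hε
  -- Adding `1` avoids a separate case `a = 0`.
  have hpos : 0 < ‖a‖ + 1 := by positivity
  refine tendsto_of_tendsto_of_tendsto_of_le_of_le tendsto_const_nhds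
    (hX (ε / (‖a‖ + 1)) (by positivity)) (fun n => zero_le) fun n => ?_
  refine measure_mono fun ω (hω : ε < _) => ?_
  show ε / (‖a‖ + 1) < Dist.dist (X n ω) c
  rw [div_lt_iff₀ hpos]
  refine hω.trans_le ?_
  rw [dist_eq_norm, ← mul_sub, norm_mul, dist_eq_norm]
  nlinarith [norm_nonneg (X n ω - c)]

lemma tendstoInProb_zero_of_tendsto {c : ℕ → ℝ} (hc : Tendsto c atTop (𝓝 0)) :
    TendstoInProb P (fun n _ => c n) 0 := by
  intro ε hε
  refine tendsto_const_nhds.congr' ?_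
  filter_upwards [Metric.tendsto_nhds.1 hc ε hε] with n hn
  rw [Real.dist_0_eq_abs] at hn
  simp [not_lt.2 hn.le]

end InProbability

/-! ### Integration against the uniform law on the circle -/

section UniformCircle

lemma continuous_exp_I_mul : Continuous fun t : ℝ => Complex.exp (Complex.I * (t : ℂ)) := by
  fun_prop

instance isProbabilityMeasure_uniformUnitCircle : IsProbabilityMeasure uniformUnitCircle := by
  constructor
  rw [uniformUnitCircle, Measure.map_apply continuous_exp_I_mul.measurable MeasurableSet.univ]
  have hpos : ENNReal.ofReal (2 * Real.pi) ≠ 0 := by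
    simpa using Real.pi_pos
  rw [Set.preimage_univ, Measure.smul_apply, Measure.restrict_apply_univ, Real.volume_Ico, sub_zero,
    smul_eq_mul, ENNReal.inv_mul_cancel hpos ENNReal.ofReal_ne_top]

lemma integral_uniformUnitCircle {f : ℂ → ℂ} (hf : Continuous f) :
    ∫ x, f x ∂uniformUnitCircle
      = (2 * Real.pi)⁻¹ • ∫ t in (0 : ℝ)..(2 * Real.pi), f (Complex.exp (Complex.I * (t : ℂ))) := by
  rw [uniformUnitCircle, integral_map continuous_exp_I_mul.aemeasurable hf.aestronglyMeasurable,
    integral_smul_measure, integral_Ico_eq_integral_Ioc,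
    intervalIntegral.integral_of_le (by positivity), ENNReal.toReal_inv,
    ENNReal.toReal_ofReal (by positivity)]

lemma integrable_uniformUnitCircle {E : Type*} [NormedAddCommGroup E] {f : ℂ → E}
    [SecondCountableTopology E] (hf : Continuous f) : Integrable f uniformUnitCircle := by
  obtain ⟨B, hB⟩ := (isCompact_sphere (0 : ℂ) 1).exists_bound_of_continuousOn hf.continuousOn
  refine Integrable.of_bound hf.aestronglyMeasurable B ?_
  rw [uniformUnitCircle]
  refine (ae_map_iff continuous_exp_I_mul.aemeasurable
    (measurableSet_le hf.norm.measurable measurable_const)).2 (ae_of_all _ fun t => hB _ ?_)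
  rw [mem_sphere_zero_iff_norm, mul_comm]
  exact Complex.norm_exp_ofReal_mul_I t

lemma ae_norm_eq_one_uniformUnitCircle : ∀ᵐ x ∂uniformUnitCircle, ‖x‖ = 1 := by
  rw [uniformUnitCircle]
  refine (ae_map_iff continuous_exp_I_mul.aemeasurable
    (measurableSet_eq_fun continuous_norm.measurable measurable_const)).2 (ae_of_all _ fun t => ?_)
  rw [mul_comm]
  exact Complex.norm_exp_ofReal_mul_I t

lemma integral_pow_uniformUnitCircle {m : ℕ} (hm : m ≠ 0) :
    ∫ x, x ^ m ∂uniformUnitCircle = 0 := by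
  rw [integral_uniformUnitCircle (continuous_pow m)]
  have hc : (m : ℂ) * Complex.I ≠ 0 := mul_ne_zero (by exact_mod_cast hm) Complex.I_ne_zero
  have h : ∀ t : ℝ, Complex.exp (Complex.I * (t : ℂ)) ^ m
      = Complex.exp ((m : ℂ) * Complex.I * t) := fun t => by
    rw [← Complex.exp_nat_mul]; ring_nf
  simp only [h, integral_exp_mul_complex hc]
  have h1 : Complex.exp ((m : ℂ) * Complex.I * (2 * (Real.pi : ℂ))) = 1 := by
    rw [← Complex.exp_nat_mul_two_pi_mul_I m]
    ring_nf
  simp [h1]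

end UniformCircle

/-- A continuous function smaller than `ε` on the unit circle is, on the closed unit disk, at most
`ε` plus a multiple of the distance to the circle. -/
lemma exists_le_add_mul_one_sub_norm {φ : ℂ → ℝ} (hφ : Continuous φ) {ε : ℝ}
    (h : ∀ u, ‖u‖ = 1 → φ u < ε) (hε : 0 ≤ ε) :
    ∃ K : ℝ, ∀ z, ‖z‖ ≤ 1 → φ z ≤ ε + K * (1 - ‖z‖) := by
  obtain ⟨B, hB⟩ := (isCompact_closedBall (0 : ℂ) 1).exists_bound_of_continuousOn hφ.continuousOn
  have hcpt : IsCompact (Metric.closedBall (0 : ℂ) 1 ∩ {z | ε ≤ φ z}) :=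
    (isCompact_closedBall 0 1).inter_right (isClosed_le continuous_const hφ)
  rcases (Metric.closedBall (0 : ℂ) 1 ∩ {z | ε ≤ φ z}).eq_empty_or_nonempty with hem | hne
  · refine ⟨0, fun z hz => ?_⟩
    by_contra! hcon
    have : z ∈ Metric.closedBall (0 : ℂ) 1 ∩ {z | ε ≤ φ z} :=
      ⟨by simpa using hz, by simpa using hcon.le⟩
    simp [hem] at this
  -- Points of the disk with `φ ≥ ε` have modulus at most `‖z₀‖ < 1`, so there `B ≤ B / (1 - ‖z₀‖) *
  -- (1 - ‖z‖)`.
  · obtain ⟨z₀, ⟨hz₀, hz₀'⟩, hmax⟩ := hcpt.exists_isMaxOn hne continuous_norm.continuousOn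
    have hr : ‖z₀‖ < 1 := lt_of_le_of_ne (by simpa using hz₀) fun h1 => (h z₀ h1).not_ge hz₀'
    have hB0 : 0 ≤ B := (norm_nonneg _).trans (hB z₀ hz₀)
    refine ⟨B / (1 - ‖z₀‖), fun z hz => ?_⟩
    rcases lt_or_ge (φ z) ε with hlt | hge
    · have : 0 ≤ B / (1 - ‖z₀‖) * (1 - ‖z‖) :=
        mul_nonneg (div_nonneg hB0 (by linarith)) (by linarith)
      linarith
    · have hzb : z ∈ Metric.closedBall (0 : ℂ) 1 := by simpa using hz
      have hle : ‖z‖ ≤ ‖z₀‖ := hmax ⟨hzb, hge⟩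
      have h1 : B ≤ B / (1 - ‖z₀‖) * (1 - ‖z‖) := by
        rw [div_mul_eq_mul_div, le_div_iff₀ (by linarith)]
        exact mul_le_mul_of_nonneg_left (by linarith) hB0
      linarith [le_abs_self (φ z), hB z hzb, Real.norm_eq_abs (φ z)]

lemma tendsto_inv_mul_log_div {δ : ℝ} (hδ : 0 < δ) :
    Tendsto (fun k : ℕ => (k : ℝ)⁻¹ * Real.log (((k : ℝ) + 1) / δ)) atTop (𝓝 0) := by
  have hx : Tendsto (fun k : ℕ => ((k : ℝ) + 1) / δ) atTop atTop :=
    (tendsto_atTop_add_const_right _ _ tendsto_natCast_atTop_atTop).atTop_div_const hδ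
  have h1 : Tendsto (fun k : ℕ => Real.log (((k : ℝ) + 1) / δ) / (((k : ℝ) + 1) / δ)) atTop (𝓝 0) :=
    Real.isLittleO_log_id_atTop.tendsto_div_nhds_zero.comp hx
  have h2 : Tendsto (fun k : ℕ => (1 + (k : ℝ)⁻¹) / δ) atTop (𝓝 ((1 + 0) / δ)) :=
    (tendsto_inv_atTop_nhds_zero_nat.const_add 1).div_const δ
  have h3 := h1.mul h2
  rw [zero_mul] at h3
  refine h3.congr' ?_
  filter_upwards [eventually_gt_atTop 0] with k hk
  have hk' : (0 : ℝ) < k := by exact_mod_cast hk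
  field_simp

/-! ### Asymptotics of the critical points -/

section CriticalPointsInProbability

variable {Ω : ℕ → Type*} [∀ n, MeasurableSpace (Ω n)] {P : ∀ n, Measure (Ω n)}
  {θ : ∀ n : ℕ, Fin n → Ω n → ℝ}

/-- The critical points concentrate near the unit circle. -/
lemma tendstoInProb_integral_one_sub_norm
    (h₁ : Tendsto
      (fun δ : ℝ => limsup
        (fun n => P n {ω | ‖∑ j, Complex.exp (-(Complex.I * (θ n j ω : ℂ)))‖ ≤ δ}) atTop)
      (𝓝[>] 0) (𝓝 0)) :
    TendstoInProb P (fun n ω => ∫ x, (1 - ‖x‖)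
      ∂(rootMeasure (derivative (polyOfAngles fun j => θ n j ω)))) (0 : ℝ) := by
  intro ε hε
  have hlim : limsup (fun n => P n {ω | ε < dist (∫ x, (1 - ‖x‖)
      ∂(rootMeasure (derivative (polyOfAngles fun j => θ n j ω)))) (0 : ℝ)}) atTop ≤ 0 := by
    -- For fixed `δ` and large `n` the logarithmic bound is below `ε`, so a deviation forces the sum
    -- of inverse roots into the `δ`-ball; then `δ → 0`.
    refine ge_of_tendsto h₁ ?_
    filter_upwards [self_mem_nhdsWithin] with δ hδ
    have hδ : 0 < δ := hδ
    refine limsup_le_limsup ?_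
    have hev := (tendsto_add_atTop_iff_nat (f := fun n : ℕ =>
      ((n - 1 : ℕ) : ℝ)⁻¹ * Real.log ((((n - 1 : ℕ) : ℝ) + 1) / δ)) 1).1
      (by simpa using tendsto_inv_mul_log_div hδ)
    filter_upwards [hev.eventually (gt_mem_nhds hε), eventually_ge_atTop 2] with n hn hn2
    obtain ⟨k, rfl⟩ : ∃ k, n = k + 1 := ⟨n - 1, by omega⟩
    refine measure_mono fun ω (hω : ε < dist _ _) => ?_
    obtain ⟨w, hw1, -, hw, -, hlog⟩ := exists_criticalPoints_of_angles fun j => θ (k + 1) j ω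
    by_contra hσ
    have hσ' : ¬ ‖∑ j, Complex.exp (-(Complex.I * (θ (k + 1) j ω : ℂ)))‖ ≤ δ := hσ
    have hle := hlog δ hδ (not_le.1 hσ')
    have hnn : 0 ≤ ∑ i, (1 - ‖w i‖) := Finset.sum_nonneg fun i _ => sub_nonneg.2 (hw1 i)
    rw [hw, Real.dist_0_eq_abs, smul_eq_mul, abs_of_nonneg (by positivity)] at hω
    simp only [Nat.add_sub_cancel] at hn
    have := mul_le_mul_of_nonneg_left hle (inv_nonneg.2 (Nat.cast_nonneg (α := ℝ) k))
    linarith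
  exact tendsto_of_le_liminf_of_limsup_le zero_le hlim

lemma tendstoInProb_integral_pow {m : ℕ} (hm : m ≠ 0)
    (h₃ : TendstoInProb P
        (fun n ω => (1 / (n : ℂ)) * ∑ j, Complex.exp (Complex.I * (θ n j ω : ℂ) * (m : ℂ))) 0) :
    TendstoInProb P (fun n ω => ∫ x, x ^ m
      ∂(rootMeasure (derivative (polyOfAngles fun j => θ n j ω))))
      (∫ x, x ^ m ∂uniformUnitCircle) := by
  rw [integral_pow_uniformUnitCircle hm]
  have hc : Tendsto (fun n : ℕ => (2 ^ (m + 1) - 1 : ℝ) * ((n - 1 : ℕ) : ℝ)⁻¹) atTop (𝓝 0) := by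
    have := (tendsto_inv_atTop_nhds_zero_nat (𝕜 := ℝ)).const_mul (2 ^ (m + 1) - 1 : ℝ)
    rw [mul_zero] at this
    exact this.comp (tendsto_sub_atTop_nat 1)
  -- The factor `2` comes from `1 / (n - 1) ≤ 2 / n` for `n ≥ 2`.
  have hY := (tendstoInProb_zero_of_tendsto (P := P) hc).add (h₃.dist.const_mul 2)
  rw [mul_zero, add_zero] at hY
  refine tendstoInProb_of_forall_dist_le fun ε hε => ⟨_, hY, ?_⟩
  filter_upwards [eventually_ge_atTop 2] with n hn ω
  obtain ⟨k, rfl⟩ : ∃ k, n = k + 1 := ⟨n - 1, by omega⟩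
  have hk : (1 : ℝ) ≤ k := by exact_mod_cast (by omega : 1 ≤ k)
  obtain ⟨w, -, hw, -, hpow, -⟩ := exists_criticalPoints_of_angles fun j => θ (k + 1) j ω
  have hp := hpow m
  have hexp : ∑ j, Complex.exp (Complex.I * (θ (k + 1) j ω : ℂ) * (m : ℂ))
      = ∑ j, Complex.exp (Complex.I * (θ (k + 1) j ω : ℂ)) ^ m :=
    Finset.sum_congr rfl fun j _ => by rw [← Complex.exp_nat_mul, mul_comm]
  rw [hw, hexp, dist_zero_right, dist_zero_right, norm_smul, norm_mul, norm_div, norm_one,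
    Complex.norm_natCast, Nat.add_sub_cancel, norm_inv, Real.norm_natCast]
  set S := ∑ j, Complex.exp (Complex.I * (θ (k + 1) j ω : ℂ)) ^ m
  have htri : ‖∑ i, w i ^ m‖ ≤ (2 ^ (m + 1) - 1) + ‖S‖ := by
    have := norm_add_le (∑ i, w i ^ m - S) S
    rw [sub_add_cancel] at this
    linarith
  have hinv : (k : ℝ)⁻¹ ≤ 2 * (1 / ((k + 1 : ℕ) : ℝ)) := by
    push_cast
    rw [mul_one_div, inv_eq_one_div, div_le_div_iff₀ (by positivity) (by positivity)]
    linarith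
  have h1 := mul_le_mul_of_nonneg_left htri (by positivity : 0 ≤ (k : ℝ)⁻¹)
  have h2 := mul_le_mul_of_nonneg_right hinv (norm_nonneg S)
  linarith

/-- Convergence of the empirical averages for trigonometric polynomials, extended to the plane as
harmonic polynomials. -/
lemma exists_harmonic_extension
    (h₃ : ∀ m : ℕ, 1 ≤ m →
      TendstoInProb P
        (fun n ω => (1 / (n : ℂ)) * ∑ j, Complex.exp (Complex.I * (θ n j ω : ℂ) * (m : ℂ))) 0)
    {F : C(AddCircle (2 * Real.pi), ℂ)}
    (hF : F ∈ Submodule.span ℂ (Set.range (@fourier (2 * Real.pi)))) :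
    ∃ h : ℂ → ℂ, Continuous h ∧ (∀ t, h (AddCircle.toCircle t : ℂ) = F t) ∧
      TendstoInProb P (fun n ω => ∫ x, h x
        ∂(rootMeasure (derivative (polyOfAngles fun j => θ n j ω))))
        (∫ x, h x ∂uniformUnitCircle) := by
  have hpow : ∀ m : ℕ, TendstoInProb P (fun n ω => ∫ x, x ^ m
      ∂(rootMeasure (derivative (polyOfAngles fun j => θ n j ω))))
      (∫ x, x ^ m ∂uniformUnitCircle) := by
    intro m
    rcases Nat.eq_zero_or_pos m with rfl | hm
    -- For `m = 0` both integrals are `1` once `n ≥ 2`, when a critical point exists.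
    · refine tendstoInProb_of_forall_dist_le fun ε hε =>
        ⟨_, tendstoInProb_zero_of_tendsto tendsto_const_nhds, ?_⟩
      filter_upwards [eventually_ge_atTop 2] with n hn ω
      obtain ⟨k, rfl⟩ : ∃ k, n = k + 1 := ⟨n - 1, by omega⟩
      have hk : (k : ℂ) ≠ 0 := by exact_mod_cast (by omega : k ≠ 0)
      obtain ⟨w, -, hw, -⟩ := exists_criticalPoints_of_angles fun j => θ (k + 1) j ω
      rw [hw]
      simp [hk, hε.le]
    · exact tendstoInProb_integral_pow hm.ne' (h₃ m hm)
  induction hF using Submodule.span_induction with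
  | mem F hF =>
    obtain ⟨m, rfl⟩ := hF
    rcases Int.eq_nat_or_neg m with ⟨m, rfl | rfl⟩
    · refine ⟨fun z => z ^ m, continuous_pow m, fun t => ?_, hpow m⟩
      simp [fourier_apply, AddCircle.toCircle_nsmul]
    -- Negative frequencies extend by conjugates, not by inverse powers, so continuity holds at `0`
    -- and the moments are conjugates of known ones.
    · refine ⟨fun z => starRingEnd ℂ (z ^ m), by fun_prop, fun t => ?_, ?_⟩
      · rw [fourier_neg]
        simp [fourier_apply, AddCircle.toCircle_nsmul]
      · refine (hpow m).of_dist_le (Eventually.of_forall fun n ω => ?_)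
        rw [integral_conj, integral_conj, dist_eq_norm, ← map_sub, RCLike.norm_conj, dist_eq_norm]
  | zero =>
    refine ⟨fun _ => 0, continuous_const, fun t => rfl, ?_⟩
    simpa using (hpow 1).const_mul 0
  | add F G _ _ ihF ihG =>
    obtain ⟨f, hf, hfF, hfP⟩ := ihF
    obtain ⟨g, hg, hgG, hgP⟩ := ihG
    refine ⟨fun z => f z + g z, hf.add hg, fun t => by simp [hfF, hgG], ?_⟩
    refine (hfP.add hgP).of_dist_le ?_
    filter_upwards [eventually_ge_atTop 1] with n hn ω
    obtain ⟨k, rfl⟩ : ∃ k, n = k + 1 := ⟨n - 1, by omega⟩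
    obtain ⟨w, -, hw, -⟩ := exists_criticalPoints_of_angles fun j => θ (k + 1) j ω
    rw [hw, hw, hw, integral_add (integrable_uniformUnitCircle hf) (integrable_uniformUnitCircle hg),
      Finset.sum_add_distrib, smul_add]
  | smul a F _ ih =>
    obtain ⟨f, hf, hfF, hfP⟩ := ih
    refine ⟨fun z => a * f z, continuous_const.mul hf, fun t => by simp [hfF], ?_⟩
    refine (hfP.const_mul a).of_dist_le (Eventually.of_forall fun n ω => ?_)
    rw [integral_const_mul, integral_const_mul]

lemma exists_toCircle_eq {u : ℂ} (hu : ‖u‖ = 1) :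
    ∃ t : AddCircle (2 * Real.pi), (AddCircle.toCircle t : ℂ) = u := by
  refine ⟨(u.arg : ℝ), ?_⟩
  rw [AddCircle.toCircle_apply_mk, div_self (by positivity), one_mul, Circle.coe_exp]
  simpa [hu] using Complex.norm_mul_exp_arg_mul_I u

end CriticalPointsInProbability

/-! ### Weak convergence -/

theorem theorem2p5
    {Ω : ℕ → Type*} [∀ n, MeasurableSpace (Ω n)]
    (P : ∀ n, Measure (Ω n)) [∀ n, IsProbabilityMeasure (P n)]
    (θ : ∀ n : ℕ, Fin n → Ω n → ℝ)
    (hmeas : ∀ n j, Measurable (θ n j))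
    (hrange : ∀ n j ω, θ n j ω ∈ Set.Ico 0 (2 * Real.pi))
    -- anti-concentration of the sum of the inverse roots
    (h₁ : Tendsto
      (fun δ : ℝ => limsup
        (fun n => P n {ω | ‖∑ j, Complex.exp (-(Complex.I * (θ n j ω : ℂ)))‖ ≤ δ}) atTop)
      (𝓝[>] 0) (𝓝 0))
    -- pointwise smallness of the logarithmic derivative, with the extended logarithm `log 0 = -∞`
    (h₂ : ∀ᵐ z ∂((volume : Measure ℂ).restrict (Metric.ball 0 1)),
      ERealTendstoZeroInProb P (fun n ω =>
        ENNReal.log ‖∑ j, 1 / (z - Complex.exp (Complex.I * (θ n j ω : ℂ)))‖ₑ / (n : EReal)))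
    -- the power sums of the roots are negligible
    (h₃ : ∀ m : ℕ, 1 ≤ m →
      TendstoInProb P
        (fun n ω => (1 / (n : ℂ)) * ∑ j, Complex.exp (Complex.I * (θ n j ω : ℂ) * (m : ℂ))) 0) :
    TendstoWeaklyInProb P
      (fun n ω => rootMeasure (derivative (polyOfAngles (fun j => θ n j ω))))
      uniformUnitCircle := by
  intro f
  refine tendstoInProb_of_forall_dist_le fun ε hε => ?_
  have hε2 : 0 < ε / 2 := half_pos hε
  let fc : ℂ → ℂ := fun z => (f z : ℂ)
  have hfc : Continuous fc := Complex.continuous_ofReal.comp f.continuous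
  have : Fact (0 < 2 * Real.pi) := ⟨by positivity⟩
  let F₀ : C(AddCircle (2 * Real.pi), ℂ) :=
    ⟨fun t => fc (AddCircle.toCircle t : ℂ),
      hfc.comp (continuous_subtype_val.comp AddCircle.continuous_toCircle)⟩
  have hF₀ : F₀ ∈ (Submodule.span ℂ (Set.range (@fourier (2 * Real.pi)))).topologicalClosure := by
    rw [span_fourier_closure_eq_top]; trivial
  obtain ⟨F, hF, hdist⟩ := Metric.mem_closure_iff.1 hF₀ (ε / 2) hε2
  obtain ⟨h, hh, hhF, hhP⟩ := exists_harmonic_extension h₃ hF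
  have hcircle : ∀ u : ℂ, ‖u‖ = 1 → ‖fc u - h u‖ < ε / 2 := by
    intro u hu
    obtain ⟨t, rfl⟩ := exists_toCircle_eq hu
    rw [hhF, ← dist_eq_norm]
    exact (ContinuousMap.dist_apply_le_dist t).trans_lt hdist
  obtain ⟨K, hK⟩ := exists_le_add_mul_one_sub_norm (hfc.sub hh).norm hcircle hε2.le
  -- This variable dominates the deviation up to `ε`: half comes from approximating `f` at the
  -- critical points, half from approximating it under the limit law.
  have hY := ((tendstoInProb_integral_one_sub_norm h₁).const_mul K).add hhP.dist
  rw [mul_zero, add_zero] at hY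
  refine ⟨_, hY, ?_⟩
  have hlim : ‖∫ x, fc x ∂uniformUnitCircle - ∫ x, h x ∂uniformUnitCircle‖ ≤ ε / 2 := by
    rw [← integral_sub (integrable_uniformUnitCircle hfc) (integrable_uniformUnitCircle hh)]
    refine (norm_integral_le_of_norm_le_const (C := ε / 2) ?_).trans (by simp)
    filter_upwards [ae_norm_eq_one_uniformUnitCircle] with x hx using (hcircle x hx).le
  filter_upwards [eventually_ge_atTop 2] with n hn ω
  obtain ⟨k, rfl⟩ : ∃ k, n = k + 1 := ⟨n - 1, by omega⟩
  have hk : (0 : ℝ) < k := by exact_mod_cast (by omega : 0 < k)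
  obtain ⟨w, hw1, hwc, hwr, -⟩ := exists_criticalPoints_of_angles fun j => θ (k + 1) j ω
  have hreal : dist (∫ x, f x ∂(rootMeasure (derivative (polyOfAngles fun j => θ (k + 1) j ω))))
      (∫ x, f x ∂uniformUnitCircle)
      = ‖(k : ℝ)⁻¹ • ∑ i, fc (w i) - ∫ x, fc x ∂uniformUnitCircle‖ := by
    have hof : ∀ ν : Measure ℂ, ∫ x, fc x ∂ν = ((∫ x, f x ∂ν : ℝ) : ℂ) := fun ν => integral_ofReal
    rw [← hwc, hof, hof, ← Complex.ofReal_sub, Complex.norm_real, dist_eq_norm]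
  have hsum : ‖(k : ℝ)⁻¹ • ∑ i, fc (w i) - (k : ℝ)⁻¹ • ∑ i, h (w i)‖
      ≤ ε / 2 + K * ((k : ℝ)⁻¹ • ∑ i, (1 - ‖w i‖)) := by
    rw [← smul_sub, ← Finset.sum_sub_distrib, norm_smul, norm_inv, Real.norm_natCast, smul_eq_mul]
    have hb := norm_sum_le_of_le (f := fun i => fc (w i) - h (w i)) Finset.univ
      fun i _ => hK (w i) (hw1 i)
    have hb' := mul_le_mul_of_nonneg_left hb (inv_nonneg.2 hk.le)
    refine hb'.trans (le_of_eq ?_)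
    rw [Finset.sum_add_distrib, ← Finset.mul_sum]
    simp only [Finset.sum_const, Finset.card_univ, Fintype.card_fin, nsmul_eq_mul]
    field_simp
  rw [hreal, hwr, hwc, dist_eq_norm]
  have htri := norm_add₃_le (a := (k : ℝ)⁻¹ • ∑ i, fc (w i) - (k : ℝ)⁻¹ • ∑ i, h (w i))
    (b := (k : ℝ)⁻¹ • ∑ i, h (w i) - ∫ x, h x ∂uniformUnitCircle)
    (c := ∫ x, h x ∂uniformUnitCircle - ∫ x, fc x ∂uniformUnitCircle)
  rw [sub_add_sub_cancel, sub_add_sub_cancel, norm_sub_rev (∫ x, h x ∂uniformUnitCircle)] at htri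
  linarith
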